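/- Let $\Gamma$ be an infinite set and let $c_0(\Gamma)$ be the Banach space of all real functions $x$ on $\Gamma$ such that $\{\gamma : |x(\gamma)|>\varepsilon\}$ is finite for every $\varepsilon>0$, with the supremum norm $\|\cdot\|_\infty$. Then $c_0(\Gamma)$ admits an equivalent norm $N$ with all of the following properties. (1) $N$ is $C^\infty$-smooth: it is infinitely Fréchet differentiable on $c_0(\Gamma)\setminus\{0\}$. (2) $N$ locally depends on finitely many coordinates (LFC): every $x\neq 0$ has an open neighbourhood $W$ for which there are finitely many continuous linear functionals $f_1,\dots,f_n\in c_0(\Gamma)^*$ such that $N(y)=N(z)$ whenever $y,z\in W$ and $f_i(y)=f_i(z)$ for $i=1,\dots,n$. (3) The closed unit ball $B_N=\{x : N(x)\le 1\}$ is dentable: for every $\varepsilon>0$ there are $f\in c_0(\Gamma)^*$ and $a>0$ such that the slice $\{x\in B_N : f(x)>a\}$ is non-empty and has diameter less than $\varepsilon$. (4) $N$ is not uniformly Gâteaux in any direction: for every $h\in c_0(\Gamma)\setminus\{0\}$, the quotient $\frac{N(x+th)+N(x-th)-2N(x)}{t}$ does not converge to $0$ as $t\to 0$ uniformly in $x$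 on the unit sphere of any equivalent norm on $c_0(\Gamma)$. (5) $B_N$ has no extreme points; in particular, no point of the unit sphere of $N$ is an extreme point of $B_N$. -/

import Mathlib

open Filter Topology
open scoped ContDiff ZeroAtInfty

/-- `p` is an equivalent norm on the normed space `E`: a seminorm bounded above and below by
positive multiples of the given norm (so in particular `p x = 0` only for `x = 0`). -/
def IsEquivNorm {E : Type*} [NormedAddCommGroup E] [NormedSpace ℝ E] (p : Seminorm ℝ E) : Prop :=
  ∃ c C : ℝ, 0 < c ∧ 0 < C ∧ ∀ x : E, c * ‖x‖ ≤ p x ∧ p x ≤ C * ‖x‖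

/-- `f` locally depends on finitely many coordinates at `x`: on some neighbourhood of `x`,
the value of `f` is determined by the values of finitely many continuous linear functionals. -/
def LFCAt {E : Type*} [NormedAddCommGroup E] [NormedSpace ℝ E] (f : E → ℝ) (x : E) : Prop :=
  ∃ W : Set E, IsOpen W ∧ x ∈ W ∧ ∃ F : Finset (E →L[ℝ] ℝ),
    ∀ y ∈ W, ∀ z ∈ W, (∀ φ ∈ F, φ y = φ z) → f y = f z

/-- A norm is LFC if it locally depends on finitely many coordinates at every nonzero point. -/
def IsLFCNorm {E : Type*} [NormedAddCommGroup E] [NormedSpace ℝ E] (p : Seminorm ℝ E) : Prop :=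
  ∀ x : E, x ≠ 0 → LFCAt p x

/-- A norm is `C^∞`-smooth if it is infinitely Fréchet differentiable away from the origin. -/
def IsSmoothNorm {E : Type*} [NormedAddCommGroup E] [NormedSpace ℝ E] (p : Seminorm ℝ E) : Prop :=
  ContDiffOn ℝ ∞ p {0}ᶜ

/-- The slice of `A` defined by the functional `φ` and the number `a`. -/
def slice {E : Type*} [NormedAddCommGroup E] [NormedSpace ℝ E]
    (A : Set E) (φ : E →L[ℝ] ℝ) (a : ℝ) : Set E :=
  {x ∈ A | a < φ x}

/-- `A` is dentable: it has nonempty slices of arbitrarily small diameter. The diameter is the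
extended one, so that unbounded sets have infinite diameter; passing to an equivalent norm
does not change the notion. -/
def IsDentable {E : Type*} [NormedAddCommGroup E] [NormedSpace ℝ E] (A : Set E) : Prop :=
  ∀ ε : ℝ, 0 < ε → ∃ (φ : E →L[ℝ] ℝ) (a : ℝ), 0 < a ∧
    (slice A φ a).Nonempty ∧ Metric.ediam (slice A φ a) < ENNReal.ofReal ε

/-- The symmetric difference quotient `(p (x + t h) + p (x - t h) - 2 p x) / t`. -/
noncomputable def symmQuotient {E : Type*} [NormedAddCommGroup E] [NormedSpace ℝ E]
    (p : Seminorm ℝ E) (x h : E) (t : ℝ) : ℝ :=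
  (p (x + t • h) + p (x - t • h) - 2 * p x) / t

/-- `p` is uniformly Gâteaux in the direction `h`: the symmetric difference quotient tends to `0`
as `t → 0`, uniformly for `x` in the unit sphere of an equivalent norm (by homogeneity, it does
not matter which one). -/
def IsUniformlyGateaux {E : Type*} [NormedAddCommGroup E] [NormedSpace ℝ E]
    (p : Seminorm ℝ E) (h : E) : Prop :=
  ∃ q : Seminorm ℝ E, IsEquivNorm q ∧
    TendstoUniformlyOn (fun t x => symmQuotient p x h t) (fun _ => 0) (𝓝[≠] (0 : ℝ)) {x | q x = 1}

/-! The unit ball is a rounding of the polyhedron `|x γ| ≤ 2 - θ γ`, `|x γ| + |x δ| ≤ 2` for `γ ≠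
δ`, where the weights `θ γ` in `(0, 1]` are positive but below every `ε > 0` infinitely often. The
rounding keeps the spikes `(2 - 2 * θ γ) • single γ` in the ball.

Rounding (`exists_smooth_lfc_norm`): each constraint `|f i x| ≤ 1` is traded for a smooth convex
well vanishing while `|f i x| ≤ 1 - η i`, and the wells are summed. Near any point of the polyhedron
only finitely many wells are active (`exists_finset_spikeFunctional_le`), so the sphere is locally a
level set of a smooth convex function of finitely many functionals. The implicit function theorem
gives smoothness. LFC leaves a flat direction at each nonzero point, so in infinite dimensions there
are no extreme points.

The spikes give the rest. Where `x γ` is close to `2`, the pair constraints force all other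
coordinates to be small, hence small slices. Moving from the spike at `δ` along `±h` with `h γ ≠ 0`
increases `|x γ| + |x δ|` linearly on both sides, up to an error of order `θ δ`; letting `θ δ` be
small refutes uniform Gâteaux smoothness. -/

/-! ### Smooth convex wells on the real line. -/

/-- A smooth convex nondecreasing function vanishing exactly on the nonpositive reals. -/
noncomputable def smoothRamp (t : ℝ) : ℝ := ∫ s in (0 : ℝ)..t, Real.smoothTransition s

theorem hasDerivAt_smoothRamp (t : ℝ) : HasDerivAt smoothRamp (Real.smoothTransition t) t :=
  intervalIntegral.integral_hasDerivAt_right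
    (Real.smoothTransition.continuous.intervalIntegrable _ _)
    Real.smoothTransition.continuous.aestronglyMeasurable.stronglyMeasurableAtFilter
    Real.smoothTransition.continuous.continuousAt

theorem deriv_smoothRamp : deriv smoothRamp = Real.smoothTransition :=
  funext fun t => (hasDerivAt_smoothRamp t).deriv

theorem differentiable_smoothRamp : Differentiable ℝ smoothRamp :=
  fun t => (hasDerivAt_smoothRamp t).differentiableAt

theorem contDiff_smoothRamp : ContDiff ℝ ∞ smoothRamp :=
  contDiff_infty_iff_deriv.2
    ⟨differentiable_smoothRamp, deriv_smoothRamp ▸ Real.smoothTransition.contDiff⟩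

theorem convexOn_smoothRamp : ConvexOn ℝ Set.univ smoothRamp :=
  Monotone.convexOn_univ_of_deriv differentiable_smoothRamp
    (deriv_smoothRamp ▸ Real.smoothTransition.monotone)

theorem monotone_smoothRamp : Monotone smoothRamp :=
  monotone_of_deriv_nonneg differentiable_smoothRamp fun t => by
    rw [deriv_smoothRamp]; exact Real.smoothTransition.nonneg t

theorem smoothRamp_of_nonpos {t : ℝ} (ht : t ≤ 0) : smoothRamp t = 0 := by
  unfold smoothRamp
  rw [intervalIntegral.integral_congr (g := fun _ => 0)]
  · simp
  · intro s hs
    rw [Set.uIcc_of_ge ht] at hs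
    exact Real.smoothTransition.zero_of_nonpos hs.2

theorem smoothRamp_nonneg (t : ℝ) : 0 ≤ smoothRamp t := by
  rcases le_total t 0 with h | h
  · rw [smoothRamp_of_nonpos h]
  · rw [← smoothRamp_of_nonpos le_rfl]
    exact monotone_smoothRamp h

theorem smoothRamp_pos {t : ℝ} (ht : 0 < t) : 0 < smoothRamp t :=
  intervalIntegral.intervalIntegral_pos_of_pos_on
    (Real.smoothTransition.continuous.intervalIntegrable _ _)
    (fun _ hs => Real.smoothTransition.pos_of_pos hs.1) ht

/-- A smooth convex even function on `ℝ` that vanishes on `[-(1 - η), 1 - η]` and exceeds `1`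
outside `[-1, 1]`. -/
theorem exists_smooth_convex_even_well {η : ℝ} (hη : 0 < η) :
    ∃ φ : ℝ → ℝ, ContDiff ℝ ∞ φ ∧ ConvexOn ℝ Set.univ φ ∧ (∀ t, φ (-t) = φ t) ∧ (∀ t, 0 ≤ φ t) ∧
      (∀ t, |t| ≤ 1 - η → φ t = 0) ∧ ∀ t, φ t ≤ 1 → |t| ≤ 1 := by
  -- With this factor the well is at least `2` wherever `|t| > 1`, since one of the two ramps then
  -- has argument at least `η`.
  have hM : 0 < 2 / smoothRamp η := div_pos two_pos (smoothRamp_pos hη)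
  refine ⟨fun t => 2 / smoothRamp η * (smoothRamp (t - (1 - η)) + smoothRamp (-t - (1 - η))),
    ?_, ?_, ?_, ?_, ?_, ?_⟩
  · exact contDiff_const.mul ((contDiff_smoothRamp.comp (contDiff_id.sub contDiff_const)).add
      (contDiff_smoothRamp.comp (contDiff_neg.sub contDiff_const)))
  · have h1 : ConvexOn ℝ Set.univ fun t => smoothRamp (t - (1 - η)) :=
      ⟨convex_univ, fun x _ y _ a b ha hb hab => by
        have := convexOn_smoothRamp.2 (Set.mem_univ (x - (1 - η))) (Set.mem_univ (y - (1 - η)))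
          ha hb hab
        rwa [show a • (x - (1 - η)) + b • (y - (1 - η)) = a • x + b • y - (1 - η) by
          simp only [smul_eq_mul]; linear_combination -(1 - η) * hab] at this⟩
    have h2 : ConvexOn ℝ Set.univ fun t => smoothRamp (-t - (1 - η)) :=
      ⟨convex_univ, fun x _ y _ a b ha hb hab => by
        have := convexOn_smoothRamp.2 (Set.mem_univ (-x - (1 - η))) (Set.mem_univ (-y - (1 - η)))
          ha hb hab
        rwa [show a • (-x - (1 - η)) + b • (-y - (1 - η)) = -(a • x + b • y) - (1 - η) by
          simp only [smul_eq_mul]; linear_combination -(1 - η) * hab] at this⟩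
    exact (h1.add h2).smul hM.le
  · intro t; simp only [neg_neg]; ring
  · intro t
    exact mul_nonneg hM.le (add_nonneg (smoothRamp_nonneg _) (smoothRamp_nonneg _))
  · intro t ht
    have := abs_le.1 ht
    simp only
    rw [smoothRamp_of_nonpos (show t - (1 - η) ≤ 0 by linarith),
      smoothRamp_of_nonpos (show -t - (1 - η) ≤ 0 by linarith)]
    simp
  · intro t ht
    by_contra! h
    have key : smoothRamp η ≤ smoothRamp (t - (1 - η)) + smoothRamp (-t - (1 - η)) := by
      rcases lt_abs.1 h with h | h
      · have := monotone_smoothRamp (show η ≤ t - (1 - η) by linarith)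
        linarith [smoothRamp_nonneg (-t - (1 - η))]
      · have := monotone_smoothRamp (show η ≤ -t - (1 - η) by linarith)
        linarith [smoothRamp_nonneg (t - (1 - η))]
    have h2 := mul_le_mul_of_nonneg_left key hM.le
    rw [div_mul_cancel₀ _ (smoothRamp_pos hη).ne'] at h2
    linarith

/-! ### Smoothness and LFC read off the unit sphere. -/

section
variable {E : Type*} [NormedAddCommGroup E] [NormedSpace ℝ E]

/-- If near a point `x` of its unit sphere a seminorm has its unit sphere contained in the level
set `{Φ = 1}` of a smooth convex function with `Φ 0 = 0`, then it is smooth at `x`. -/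
theorem Seminorm.contDiffAt_of_level_set [CompleteSpace E] (p : Seminorm ℝ E) (hp : Continuous p)
    {Φ : E → ℝ} (hΦ : ContDiff ℝ ∞ Φ) (hconv : ConvexOn ℝ Set.univ Φ) (h0 : Φ 0 = 0) {x : E}
    (hx : p x = 1) (hlev : ∀ᶠ y in 𝓝 x, p y = 1 → Φ y = 1) : ContDiffAt ℝ ∞ p x := by
  set f : E × ℝ → ℝ := fun v => Φ (v.2 • v.1) with hf
  have hfd : ContDiff ℝ ∞ f := hΦ.comp (contDiff_snd.smul contDiff_fst)
  have cdf : ContDiffAt ℝ ∞ f (x, 1) := hfd.contDiffAt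
  have hΦx : Φ x = 1 := hlev.self_of_nhds hx
  set L : ℝ →L[ℝ] ℝ := fderiv ℝ f (x, 1) ∘L .inr ℝ E ℝ with hL
  have hderiv : HasDerivAt (fun t : ℝ => Φ (t • x)) (L 1) 1 := by
    have h1 : HasFDerivAt f (fderiv ℝ f (x, 1)) (x, 1) :=
      (hfd.differentiable (by simp)).differentiableAt.hasFDerivAt
    have h2 : HasDerivAt (fun t : ℝ => (x, t)) ((0 : E), (1 : ℝ)) 1 :=
      (hasDerivAt_const 1 x).prodMk (hasDerivAt_id 1)
    simpa [hL, hf, Function.comp_def] using h1.comp_hasDerivAt (1 : ℝ) h2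
  have hline : ConvexOn ℝ Set.univ (fun t : ℝ => Φ (t • x)) := by
    simpa using! hconv.comp_linearMap (LinearMap.toSpanSingleton ℝ E x)
  -- By convexity the radial derivative at `x` is at least the slope `Φ x - Φ 0 = 1`; being nonzero,
  -- it permits solving `Φ (t • y) = 1` for `t`.
  have hL1 : 1 ≤ L 1 := by
    have := hline.slope_le_of_hasDerivAt (Set.mem_univ 0) (Set.mem_univ 1) one_pos hderiv
    simpa [slope_def_field, hΦx, h0] using this
  have hinv : L.IsInvertible := by
    refine ⟨ContinuousLinearEquiv.unitsEquivAut ℝ (Units.mk0 (L 1) (by linarith)), ?_⟩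
    ext; simp
  have hne : (∞ : WithTop ℕ∞) ≠ 0 := by simp
  have hψ := cdf.contDiffAt_implicitFunction hne hinv
  have hψx := cdf.implicitFunction_apply_self hne hinv
  have hiff := cdf.eventually_apply_eq_iff_implicitFunction hne hinv
  set ψ := cdf.implicitFunction hne hinv
  have hcont : ContinuousAt (fun y => (p y)⁻¹) x := hp.continuousAt.inv₀ (by simp [hx])
  have ht1 : Tendsto (fun y => (y, (p y)⁻¹)) (𝓝 x) (𝓝 (x, 1)) := by
    have := (continuousAt_id (x := x)).prodMk hcont
    simpa [ContinuousAt, hx] using this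
  have ht2 : Tendsto (fun y => (p y)⁻¹ • y) (𝓝 x) (𝓝 x) := by
    have := hcont.tendsto.smul (tendsto_id (x := 𝓝 x))
    simpa [hx] using this
  have hpos : ∀ᶠ y in 𝓝 x, 0 < p y := hp.continuousAt.eventually_const_lt (by simp [hx])
  -- Since `(p y)⁻¹ • y` lies on the sphere, `t = (p y)⁻¹` solves `Φ (t • y) = 1`, and the solution
  -- near `1` is unique.
  have heq : p =ᶠ[𝓝 x] fun y => (ψ y)⁻¹ := by
    filter_upwards [ht1.eventually hiff, ht2.eventually hlev, hpos] with y h1 h2 h3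
    have h4 : p ((p y)⁻¹ • y) = 1 := by
      rw [map_smul_eq_mul, Real.norm_of_nonneg (inv_nonneg.2 h3.le), inv_mul_cancel₀ h3.ne']
    have h5 := h1.1 (by simpa [hf, hΦx] using h2 h4)
    rw [h5, inv_inv]
  refine ContDiffAt.congr_of_eventuallyEq (hψ.inv ?_) heq
  rw [show ψ (x, (1 : ℝ)).1 = 1 from hψx]
  exact one_ne_zero

/-- A seminorm is LFC at a point `x` of its unit sphere if membership in the closed unit ball is
determined near `x` by finitely many functionals. -/
theorem Seminorm.lfcAt_of_unit_ball (p : Seminorm ℝ E) (hp : Continuous p) {x : E}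
    (hx : p x = 1) (F : Finset (E →L[ℝ] ℝ))
    (hF : ∀ᶠ z in 𝓝 (x, x), (∀ φ ∈ F, φ z.1 = φ z.2) → p z.1 ≤ 1 → p z.2 ≤ 1) : LFCAt p x := by
  have hcont : ContinuousAt (fun y : E × E => (p y.1)⁻¹) (x, x) :=
    (hp.comp continuous_fst).continuousAt.inv₀ (by simp [hx])
  -- Scaling both points by the norm of the first puts the first on the sphere; `hF` then gives `p z
  -- ≤ p y`, and the roles can be exchanged.
  have ht : Tendsto (fun y : E × E => ((p y.1)⁻¹ • y.1, (p y.1)⁻¹ • y.2)) (𝓝 (x, x))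
      (𝓝 (x, x)) := by
    have := (hcont.smul continuousAt_fst).prodMk (hcont.smul continuousAt_snd)
    simpa [ContinuousAt, hx] using this
  have hpos : ∀ᶠ y : E × E in 𝓝 (x, x), 0 < p y.1 :=
    (hp.comp continuous_fst).continuousAt.eventually_const_lt (by simp [hx])
  obtain ⟨W, hW, hWo⟩ := mem_nhds_prod_iff.1 ((ht.eventually hF).and hpos)
  obtain ⟨V, hV, hVW⟩ := hWo
  obtain ⟨U, hUW, hU, hxU⟩ := mem_nhds_iff.1 (inter_mem hW hV)
  have key : ∀ y ∈ U, ∀ z ∈ U, (∀ φ ∈ F, φ y = φ z) → p z ≤ p y := by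
    intro y hy z hz hyz
    obtain ⟨h1, h2⟩ := hVW (Set.mk_mem_prod (hUW hy).1 (hUW hz).2)
    simp only at h1 h2
    have h3 := h1 (fun φ hφ => by rw [map_smul, map_smul, hyz φ hφ])
    rw [map_smul_eq_mul, map_smul_eq_mul, Real.norm_of_nonneg (inv_nonneg.2 h2.le),
      inv_mul_cancel₀ h2.ne'] at h3
    have h4 := h3 le_rfl
    rwa [inv_mul_le_iff₀ h2, mul_one] at h4
  exact ⟨U, hU, hxU, F, fun y hy z hz h =>
    le_antisymm (key z hz y hy fun φ hφ => (h φ hφ).symm) (key y hy z hz h)⟩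

/-- To check that a norm is smooth it suffices to look at its unit sphere. -/
theorem IsEquivNorm.isSmoothNorm {p : Seminorm ℝ E} (hp : IsEquivNorm p)
    (h : ∀ x, p x = 1 → ContDiffAt ℝ ∞ p x) : IsSmoothNorm p := by
  obtain ⟨c, C, hc, hC, hcC⟩ := hp
  intro x hx
  have hpx : 0 < p x := (mul_pos hc (norm_pos_iff.2 hx)).trans_le (hcC x).1
  refine ContDiffAt.contDiffWithinAt ?_
  have h1 : p ((p x)⁻¹ • x) = 1 := by
    rw [map_smul_eq_mul, Real.norm_of_nonneg (inv_nonneg.2 hpx.le), inv_mul_cancel₀ hpx.ne']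
  have h2 : ContDiffAt ℝ ∞ (fun y => p x * p ((p x)⁻¹ • y)) x :=
    contDiffAt_const.mul ((h _ h1).comp x (contDiffAt_const.smul contDiffAt_id))
  refine h2.congr_of_eventuallyEq (Eventually.of_forall fun y => ?_)
  beta_reduce
  rw [map_smul_eq_mul, Real.norm_of_nonneg (inv_nonneg.2 hpx.le), mul_inv_cancel_left₀ hpx.ne']

/-- To check that a norm is LFC it suffices to look at its unit sphere. -/
theorem IsEquivNorm.isLFCNorm {p : Seminorm ℝ E} (hp : IsEquivNorm p)
    (h : ∀ x, p x = 1 → LFCAt p x) : IsLFCNorm p := by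
  obtain ⟨c, C, hc, hC, hcC⟩ := hp
  intro x hx
  have hpx : 0 < p x := (mul_pos hc (norm_pos_iff.2 hx)).trans_le (hcC x).1
  have hs : ∀ y, p ((p x)⁻¹ • y) = (p x)⁻¹ * p y := fun y => by
    rw [map_smul_eq_mul, Real.norm_of_nonneg (inv_nonneg.2 hpx.le)]
  obtain ⟨W, hW, hxW, F, hF⟩ := h ((p x)⁻¹ • x) (by rw [hs, inv_mul_cancel₀ hpx.ne'])
  refine ⟨(fun y => (p x)⁻¹ • y) ⁻¹' W, hW.preimage (continuous_const_smul _), hxW, F,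
    fun y hy z hz hyz => ?_⟩
  have := hF _ hy _ hz fun φ hφ => by rw [map_smul, map_smul, hyz φ hφ]
  rw [hs, hs] at this
  exact mul_left_cancel₀ (inv_ne_zero hpx.ne') this

theorem IsEquivNorm.continuous {p : Seminorm ℝ E} (hp : IsEquivNorm p) : Continuous p := by
  obtain ⟨c, C, hc, hC, hcC⟩ := hp
  refine Seminorm.continuous_of_le (q := C.toNNReal • normSeminorm ℝ E) ?_ fun x => ?_
  · exact (continuous_norm.const_smul C.toNNReal)
  · simpa [NNReal.smul_def, hC.le] using (hcC x).2

end

/-! ### Smooth LFC norms from families of functionals; absence of extreme points. -/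

section
variable {E : Type*} [NormedAddCommGroup E] [NormedSpace ℝ E]

/-- A seminorm whose closed unit ball is a given closed convex symmetric neighbourhood of `0`. -/
theorem exists_seminorm_le_one_iff_mem {B : Set E} (hconv : Convex ℝ B) (hclosed : IsClosed B)
    (hneg : ∀ x ∈ B, -x ∈ B) (hB : B ∈ 𝓝 0) : ∃ p : Seminorm ℝ E, ∀ x, p x ≤ 1 ↔ x ∈ B := by
  refine ⟨gaugeSeminorm (𝕜 := ℝ) ((balanced_iff_neg_mem hconv).2 fun x hx => hneg x hx) hconv
    (absorbent_nhds_zero hB), fun x => ?_⟩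
  have := gauge_le_one_iff_mem_closure (x := x) hconv hB
  rwa [hclosed.closure_eq] at this

theorem Seminorm.le_mul_of_le_one_imp {p q : Seminorm ℝ E} {c : ℝ} (hc : 0 < c)
    (h : ∀ x, p x ≤ 1 → q x ≤ c) (x : E) : q x ≤ c * p x := by
  rw [← inv_mul_le_iff₀ hc]
  -- Scaling by `a > p x` rather than by `p x` covers the case `p x = 0`.
  refine le_of_forall_gt_imp_ge_of_dense fun a ha => ?_
  have ha0 : 0 < a := (apply_nonneg p x).trans_lt ha
  have hs : ∀ r : Seminorm ℝ E, r (a⁻¹ • x) = a⁻¹ * r x := fun r => by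
    rw [map_smul_eq_mul, Real.norm_of_nonneg (inv_nonneg.2 ha0.le)]
  have := h (a⁻¹ • x) (by rw [hs, inv_mul_le_iff₀ ha0, mul_one]; exact ha.le)
  rw [hs, inv_mul_le_iff₀ ha0] at this
  rwa [inv_mul_le_iff₀ hc, mul_comm]

/-- **Smooth LFC renorming.** A family of functionals which is norming, and which around each
point of `{x | ∀ i, |f i x| ≤ 1}` stays at distance at least `η i` from `1` up to finitely many
indices, yields an equivalent smooth LFC norm which is sandwiched between `sup |f i|` and the gauge
of `{x | ∀ i, |f i x| ≤ 1 - η i}`. -/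
theorem exists_smooth_lfc_norm [CompleteSpace E] {ι : Type*} (f : ι → E →L[ℝ] ℝ) (η : ι → ℝ)
    (hη : ∀ i, 0 < η i) (hη' : ∀ i, η i ≤ 1 / 2) (hf : ∀ i x, |f i x| ≤ ‖x‖) {c : ℝ} (hc : 0 < c)
    (hlow : ∀ x, (∀ i, |f i x| ≤ 1) → ‖x‖ ≤ c)
    (hloc : ∀ x, (∀ i, |f i x| ≤ 1) →
      ∃ J : Finset ι, ∀ᶠ y in 𝓝 x, ∀ i ∉ J, |f i y| ≤ 1 - η i) :
    ∃ p : Seminorm ℝ E, IsEquivNorm p ∧ IsSmoothNorm p ∧ IsLFCNorm p ∧ (∀ i x, |f i x| ≤ p x) ∧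
      ∀ x, (∀ i, |f i x| ≤ 1 - η i) → p x ≤ 1 := by
  choose φ hφs hφc hφe hφn hφ0 hφ1 using fun i => exists_smooth_convex_even_well (hη i)
  set Φ : Finset ι → E → ℝ := fun F x => ∑ i ∈ F, φ i (f i x) with hΦ
  have hΦs : ∀ F, ContDiff ℝ ∞ (Φ F) := fun F =>
    ContDiff.sum fun i _ => (hφs i).comp (f i).contDiff
  have hΦc : ∀ F, ConvexOn ℝ Set.univ (Φ F) := by
    intro F
    refine ⟨convex_univ, fun x _ y _ a b ha hb hab => ?_⟩
    simp only [hΦ, smul_eq_mul, Finset.mul_sum, ← Finset.sum_add_distrib]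
    refine Finset.sum_le_sum fun i _ => ?_
    simpa using (hφc i).2 (Set.mem_univ (f i x)) (Set.mem_univ (f i y)) ha hb hab
  have hΦ0 : ∀ F, Φ F 0 = 0 := fun F => Finset.sum_eq_zero fun i _ =>
    hφ0 i _ (by simp; linarith [hη' i])
  -- Bounding all finite partial sums stands for bounding the infinite sum of wells, with no
  -- summability to discuss.
  set B : Set E := {x | ∀ F, Φ F x ≤ 1} with hB
  have hBc : Convex ℝ B := by
    rw [hB, Set.ofPred_forall]
    refine convex_iInter fun F => ?_
    simpa using (hΦc F).convex_le 1
  have hBcl : IsClosed B := by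
    rw [hB, Set.ofPred_forall]
    exact isClosed_iInter fun F => isClosed_le (hΦs F).continuous continuous_const
  have hBn : ∀ x ∈ B, -x ∈ B := fun x hx F => by
    simpa [hΦ, hφe] using hx F
  have hsmall : ∀ x, (∀ i, |f i x| ≤ 1 - η i) → x ∈ B := fun x hx F =>
    (Finset.sum_eq_zero fun i _ => hφ0 i _ (hx i)).trans_le zero_le_one
  have hball : ∀ x, ‖x‖ ≤ 1 / 2 → x ∈ B := fun x hx =>
    hsmall x fun i => by linarith [hη' i, hf i x]
  have hBf : ∀ x ∈ B, ∀ i, |f i x| ≤ 1 := fun x hx i =>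
    hφ1 i _ (by simpa [hΦ] using hx {i})
  obtain ⟨p, hp⟩ := exists_seminorm_le_one_iff_mem hBc hBcl hBn
    (mem_of_superset (Metric.closedBall_mem_nhds 0 (by norm_num : (0 : ℝ) < 1 / 2))
      fun x hx => hball x (by simpa using hx))
  have hpeq : IsEquivNorm p := by
    refine ⟨c⁻¹, 2, inv_pos.2 hc, two_pos, fun x => ⟨?_, ?_⟩⟩
    · rw [inv_mul_le_iff₀ hc]
      exact Seminorm.le_mul_of_le_one_imp (q := normSeminorm ℝ E) hc
        (fun y hy => hlow y (hBf y ((hp y).1 hy))) x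
    · refine Seminorm.le_mul_of_le_one_imp (p := normSeminorm ℝ E) two_pos (fun y hy => ?_) x
      have h1 : p ((1 / 2 : ℝ) • y) ≤ 1 := (hp _).2 <| hball _ <| by
        rw [norm_smul, Real.norm_of_nonneg (by norm_num)]
        linarith [show ‖y‖ ≤ 1 from hy]
      rw [map_smul_eq_mul, Real.norm_of_nonneg (by norm_num)] at h1
      linarith
  have hpc := hpeq.continuous
  have hlocB : ∀ x, p x = 1 → ∃ J : Finset ι, ∀ᶠ y in 𝓝 x, ∀ F, Φ F y ≤ Φ J y := by
    intro x hx
    classical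
    obtain ⟨J, hJ⟩ := hloc x (hBf x ((hp x).1 hx.le))
    refine ⟨J, hJ.mono fun y hy F => ?_⟩
    calc Φ F y = ∑ i ∈ F with i ∈ J, φ i (f i y) := by
          rw [Finset.sum_filter]
          refine Finset.sum_congr rfl fun i _ => ?_
          split_ifs with h
          · rfl
          · exact hφ0 i _ (hy i h)
      _ ≤ Φ J y := Finset.sum_le_sum_of_subset_of_nonneg
          (fun i hi => (Finset.mem_filter.1 hi).2) fun i _ _ => hφn i _
  refine ⟨p, hpeq, hpeq.isSmoothNorm fun x hx => ?_, hpeq.isLFCNorm fun x hx => ?_,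
    fun i x => ?_, fun x hx => (hp x).2 (hsmall x hx)⟩
  · obtain ⟨J, hJ⟩ := hlocB x hx
    refine p.contDiffAt_of_level_set hpc (hΦs J) (hΦc J) (hΦ0 J) hx ?_
    filter_upwards [hJ.eventually_nhds] with y hy hpy
    -- If `Φ J y < 1`, a whole neighbourhood of `y` lies in the ball, including some `t • y` with `t
    -- > 1`, contradicting `p y = 1`.
    refine le_antisymm ((hp y).1 hpy.le J) ?_
    by_contra! hlt
    have h1 : ∀ᶠ z in 𝓝 y, p z ≤ 1 := by
      filter_upwards [hy, (hΦs J).continuous.continuousAt.eventually_lt_const hlt] with z h1 h2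
      exact (hp z).2 fun F => (h1 F).trans h2.le
    have h2 : Tendsto (fun t : ℝ => t • y) (𝓝 1) (𝓝 y) := by
      simpa using (tendsto_id (x := 𝓝 (1 : ℝ))).smul_const y
    obtain ⟨t, ht, ht1⟩ := ((h2.eventually h1).filter_mono nhdsWithin_le_nhds |>.and
      (self_mem_nhdsWithin (s := Set.Ioi (1 : ℝ)))).exists
    rw [map_smul_eq_mul, hpy, mul_one] at ht
    exact absurd ((le_abs_self t).trans ht) (not_le.2 ht1)
  · classical
    obtain ⟨J, hJ⟩ := hlocB x hx
    refine p.lfcAt_of_unit_ball hpc hx (J.image f) ?_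
    have : ∀ᶠ z : E × E in 𝓝 (x, x), ∀ F, Φ F z.2 ≤ Φ J z.2 :=
      (continuous_snd.tendsto (x, x)).eventually hJ
    filter_upwards [this] with z hz heq hz1
    refine (hp _).2 fun F => (hz F).trans ?_
    have : Φ J z.2 = Φ J z.1 := Finset.sum_congr rfl fun i hi => by
      rw [heq (f i) (Finset.mem_image_of_mem f hi)]
    exact this ▸ (hp _).1 hz1 J
  · simpa using! Seminorm.le_mul_of_le_one_imp (p := p)
      (q := (normSeminorm ℝ ℝ).comp (f i).toLinearMap) one_pos
      (fun y hy => hBf y ((hp y).1 hy) i) x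

/-- In infinite dimensions the closed unit ball of an LFC norm has no extreme points. -/
theorem IsLFCNorm.extremePoints_closedBall_eq_empty {p : Seminorm ℝ E} (hp : IsLFCNorm p)
    (hE : ¬ FiniteDimensional ℝ E) : Set.extremePoints ℝ (p.closedBall 0 1) = ∅ := by
  have aux : ∀ x h : E, h ≠ 0 → p (x + h) ≤ 1 → p (x - h) ≤ 1 →
      x ∉ Set.extremePoints ℝ (p.closedBall 0 1) := by
    intro x h hh h1 h2 hx
    have := (mem_extremePoints.1 hx).2 (x + h) (by simpa [Seminorm.mem_closedBall] using h1) (x - h)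
      (by simpa [Seminorm.mem_closedBall] using h2)
      ⟨1 / 2, 1 / 2, by norm_num, by norm_num, by norm_num, by module⟩
    exact hh (by simpa using this.1)
  rw [Set.eq_empty_iff_forall_notMem]
  intro x hx
  have hpx : p x ≤ 1 := by simpa [Seminorm.mem_closedBall] using hx.1
  by_cases hx0 : x = 0
  · have : Nontrivial E := by
      by_contra hn
      rw [not_nontrivial_iff_subsingleton] at hn
      exact hE inferInstance
    obtain ⟨h, hh⟩ := exists_ne (0 : E)
    have hpos : 0 < 1 + p h := by positivity
    have hle : p ((1 + p h)⁻¹ • h) ≤ 1 := by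
      rw [map_smul_eq_mul, Real.norm_of_nonneg (inv_nonneg.2 hpos.le), inv_mul_le_iff₀ hpos]
      linarith
    refine aux x ((1 + p h)⁻¹ • h) (smul_ne_zero (inv_ne_zero hpos.ne') hh) ?_ ?_ hx
    · simpa [hx0] using hle
    · simpa [hx0] using hle
  · obtain ⟨W, hW, hxW, F, hF⟩ := hp x hx0
    -- A nonzero vector in the common kernel: `p` is constant along short segments through `x` in
    -- this direction, so `x` is a midpoint within the ball.
    obtain ⟨h, hh, hFh⟩ : ∃ h : E, h ≠ 0 ∧ ∀ φ ∈ F, φ h = 0 := by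
      by_contra! hcon
      let L : E →ₗ[ℝ] (F → ℝ) := LinearMap.pi fun φ => (φ : E →L[ℝ] ℝ).toLinearMap
      refine hE (FiniteDimensional.of_injective L ?_)
      rw [← LinearMap.ker_eq_bot, LinearMap.ker_eq_bot']
      intro h hLh
      by_contra hh
      obtain ⟨φ, hφ, hne⟩ := hcon h hh
      exact hne (congrFun hLh ⟨φ, hφ⟩)
    have hlim : ∀ h : E, Tendsto (fun t : ℝ => x + t • h) (𝓝 0) (𝓝 x) := fun h => by
      have : Continuous fun t : ℝ => x + t • h := by fun_prop
      simpa using this.tendsto 0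
    have hWx := hW.mem_nhds hxW
    obtain ⟨t, ⟨h1, h2⟩, ht⟩ := ((((hlim h).eventually hWx).and
      ((hlim (-h)).eventually hWx)).filter_mono nhdsWithin_le_nhds |>.and
      (self_mem_nhdsWithin (s := {(0 : ℝ)}ᶜ))).exists
    refine aux x (t • h) (smul_ne_zero ht hh) ?_ ?_ hx
    · rwa [hF _ h1 x hxW fun φ hφ => by simp [hFh φ hφ]]
    · rw [sub_eq_add_neg, ← smul_neg]
      rwa [hF _ h2 x hxW fun φ hφ => by simp [hFh φ hφ]]

end

/-! ### Coordinates and unit vectors in `C₀(Γ, ℝ)` for discrete `Γ`. -/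

namespace ZeroAtInftyContinuousMap

variable {Γ : Type*} [TopologicalSpace Γ]

theorem abs_apply_le_norm (x : C₀(Γ, ℝ)) (γ : Γ) : |x γ| ≤ ‖x‖ :=
  x.toBCF.norm_coe_le_norm γ

theorem norm_le_of_forall_abs_apply_le {x : C₀(Γ, ℝ)} {c : ℝ} (hc : 0 ≤ c)
    (h : ∀ γ, |x γ| ≤ c) : ‖x‖ ≤ c :=
  (BoundedContinuousFunction.norm_le hc).2 h

/-- Evaluation at a point as a continuous linear functional. -/
noncomputable def evalCLM (γ : Γ) : C₀(Γ, ℝ) →L[ℝ] ℝ :=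
  LinearMap.mkContinuous
    { toFun := fun x => x γ
      map_add' := fun _ _ => rfl
      map_smul' := fun _ _ => rfl } 1 fun x => by simpa using abs_apply_le_norm x γ

@[simp]
theorem evalCLM_apply (γ : Γ) (x : C₀(Γ, ℝ)) : evalCLM γ x = x γ := rfl

variable [DiscreteTopology Γ]

theorem tendsto_cofinite (x : C₀(Γ, ℝ)) : Tendsto x cofinite (𝓝 0) :=
  cocompact_eq_cofinite Γ ▸ x.zero_at_infty'

theorem finite_setOf_lt_abs (x : C₀(Γ, ℝ)) {r : ℝ} (hr : 0 < r) : {γ | r < |x γ|}.Finite := by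
  have : ∀ᶠ γ in cofinite, |x γ| < r := by
    simpa using (tendsto_cofinite x).eventually (Metric.ball_mem_nhds 0 hr)
  exact (eventually_cofinite.1 this).subset fun γ h => not_lt.2 (le_of_lt h)

open Classical in
/-- The indicator function of a point. -/
noncomputable def single (γ : Γ) : C₀(Γ, ℝ) where
  toFun := Pi.single (M := fun _ => ℝ) γ 1
  continuous_toFun := continuous_of_discreteTopology
  zero_at_infty' := by
    rw [cocompact_eq_cofinite]
    refine tendsto_const_nhds.congr' ?_
    filter_upwards [(Set.finite_singleton γ).compl_mem_cofinite] with δ hδ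
    exact (Pi.single_eq_of_ne (M := fun _ => ℝ) hδ 1).symm

open Classical in
@[simp]
theorem single_self (γ : Γ) : single γ γ = 1 :=
  Pi.single_eq_same (M := fun _ => ℝ) γ 1

open Classical in
theorem single_of_ne {γ δ : Γ} (h : δ ≠ γ) : single γ δ = 0 :=
  Pi.single_eq_of_ne (M := fun _ => ℝ) h 1

theorem not_finiteDimensional [Infinite Γ] : ¬ FiniteDimensional ℝ C₀(Γ, ℝ) := by
  intro _
  have : LinearIndependent ℝ (single : Γ → C₀(Γ, ℝ)) := by
    rw [linearIndependent_iff']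
    intro s g hg γ hγ
    have h := congrArg (evalCLM γ) hg
    rw [map_sum, map_zero, Finset.sum_eq_single γ] at h
    · simpa using h
    · intro δ _ hδ
      simp [single_of_ne hδ.symm]
    · exact fun h => absurd hγ h
  exact not_finite_iff_infinite.2 ‹Infinite Γ› this.finite

end ZeroAtInftyContinuousMap

open ZeroAtInftyContinuousMap (evalCLM evalCLM_apply single single_self single_of_ne
  abs_apply_le_norm norm_le_of_forall_abs_apply_le finite_setOf_lt_abs not_finiteDimensional)

/-! ### The spiked polyhedron and its rounding. -/

section
variable {Γ : Type*} [TopologicalSpace Γ]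

/-- The functionals `x ↦ x γ / (2 - θ γ)` and `x ↦ (x γ ± x δ) / 2` for `γ ≠ δ`. -/
noncomputable def spikeFunctional (θ : Γ → ℝ) :
    Γ ⊕ ({q : Γ × Γ // q.1 ≠ q.2} × ℤˣ) → C₀(Γ, ℝ) →L[ℝ] ℝ
  | .inl γ => (2 - θ γ)⁻¹ • evalCLM γ
  | .inr (q, s) => (2⁻¹ : ℝ) • (evalCLM q.1.1 + ((s : ℤ) : ℝ) • evalCLM q.1.2)

/-- The margins kept by the functionals `spikeFunctional θ`. -/
noncomputable def spikeMargin (θ : Γ → ℝ) : Γ ⊕ ({q : Γ × Γ // q.1 ≠ q.2} × ℤˣ) → ℝ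
  | .inl γ => θ γ / 4
  | .inr (q, _) => min (θ q.1.1) (θ q.1.2) / 4

theorem abs_spikeFunctional_inr_le (θ : Γ → ℝ) (q : {q : Γ × Γ // q.1 ≠ q.2}) (s : ℤˣ)
    (x : C₀(Γ, ℝ)) : |spikeFunctional θ (.inr (q, s)) x| ≤ (|x q.1.1| + |x q.1.2|) / 2 := by
  have h : |x q.1.1 + ((s : ℤ) : ℝ) * x q.1.2| ≤ |x q.1.1| + |x q.1.2| := by
    refine (abs_add_le _ _).trans_eq ?_
    rcases Int.units_eq_one_or s with rfl | rfl <;> simp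
  simp only [spikeFunctional, smul_apply, add_apply, evalCLM_apply, smul_eq_mul,
    abs_mul (2⁻¹ : ℝ)]
  rw [abs_of_pos (by norm_num : (0 : ℝ) < 2⁻¹)]
  linarith

theorem abs_spikeFunctional_inl {θ : Γ → ℝ} (hθ : ∀ γ, θ γ ≤ 1) (γ : Γ) (x : C₀(Γ, ℝ)) :
    |spikeFunctional θ (.inl γ) x| = (2 - θ γ)⁻¹ * |x γ| := by
  have : 0 < (2 - θ γ)⁻¹ := inv_pos.2 (by linarith [hθ γ])
  simp [spikeFunctional, abs_mul, abs_of_pos this]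

theorem abs_add_abs_le_of_spikeFunctional_le {θ : Γ → ℝ} {x : C₀(Γ, ℝ)} {a : ℝ}
    (h : ∀ i, |spikeFunctional θ i x| ≤ a) {γ δ : Γ} (hγδ : γ ≠ δ) : |x γ| + |x δ| ≤ 2 * a := by
  have h1 := h (.inr (⟨(γ, δ), hγδ⟩, 1))
  have h2 := h (.inr (⟨(γ, δ), hγδ⟩, -1))
  simp only [spikeFunctional, smul_apply, add_apply, evalCLM_apply, smul_eq_mul,
    abs_mul (2⁻¹ : ℝ), abs_of_pos (by norm_num : (0 : ℝ) < 2⁻¹), Units.val_one, Units.val_neg,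
    Int.cast_one, Int.cast_neg, one_mul, neg_mul] at h1 h2
  have h3 := abs_le.1 ((inv_mul_le_iff₀ two_pos).1 h1)
  have h4 := abs_le.1 ((inv_mul_le_iff₀ two_pos).1 h2)
  rcases abs_cases (x γ) with h | h <;> rcases abs_cases (x δ) with h' | h' <;> linarith

variable [DiscreteTopology Γ]

/-- Near each point of the polyhedral body, all but finitely many functionals keep their
margin. -/
theorem exists_finset_spikeFunctional_le {θ : Γ → ℝ} (hθ0 : ∀ γ, 0 < θ γ) (hθ : ∀ γ, θ γ ≤ 1)
    (x : C₀(Γ, ℝ)) (hx : ∀ i, |spikeFunctional θ i x| ≤ 1) :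
    ∃ J : Finset (Γ ⊕ ({q : Γ × Γ // q.1 ≠ q.2} × ℤˣ)),
      ∀ᶠ y in 𝓝 x, ∀ i ∉ J, |spikeFunctional θ i y| ≤ 1 - spikeMargin θ i := by
  have hxθ : ∀ γ, |x γ| ≤ 2 - θ γ := fun γ => by
    have := hx (.inl γ)
    rwa [abs_spikeFunctional_inl hθ, inv_mul_le_iff₀ (by linarith [hθ γ]), mul_one] at this
  have hA₀ : {γ | 1 / 4 < |x γ|}.Finite := finite_setOf_lt_abs x (by norm_num)
  -- Only finitely many coordinates exceed `1 / 4`, so one radius fits them all. `J` then collects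
  -- the functionals all of whose coordinates exceed `r` in absolute value.
  obtain ⟨r, hr, hr0, hr1⟩ : ∃ r : ℝ, (∀ γ ∈ {γ | 1 / 4 < |x γ|}, r < θ γ / 8) ∧ 0 < r ∧
      r < 1 / 8 := by
    have h1 : ∀ᶠ r : ℝ in 𝓝[>] 0, ∀ γ ∈ {γ | 1 / 4 < |x γ|}, r < θ γ / 8 :=
      (eventually_all_finite hA₀).2 fun γ _ =>
        (eventually_lt_nhds (by linarith [hθ0 γ])).filter_mono nhdsWithin_le_nhds
    have h2 : ∀ᶠ r : ℝ in 𝓝[>] 0, r < 1 / 8 :=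
      (eventually_lt_nhds (by norm_num)).filter_mono nhdsWithin_le_nhds
    obtain ⟨r, h⟩ := (h1.and ((eventually_mem_nhdsWithin (s := Set.Ioi (0 : ℝ))).and h2)).exists
    exact ⟨r, h⟩
  have hA : {γ | r < |x γ|}.Finite := finite_setOf_lt_abs x hr0
  set S : Set (Γ ⊕ ({q : Γ × Γ // q.1 ≠ q.2} × ℤˣ)) :=
    Sum.inl '' {γ | r < |x γ|} ∪
      Sum.inr '' ((Subtype.val ⁻¹' ({γ | r < |x γ|} ×ˢ {γ | r < |x γ|})) ×ˢ Set.univ) with hS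
  have hSf : S.Finite := (hA.image _).union
    ((((hA.prod hA).preimage Subtype.val_injective.injOn).prod Set.finite_univ).image _)
  refine ⟨hSf.toFinset, ?_⟩
  filter_upwards [Metric.ball_mem_nhds x hr0] with y hy i hi
  have hyx : ∀ γ, |y γ| ≤ |x γ| + r := fun γ => by
    have h1 := abs_apply_le_norm (y - x) γ
    have h2 : ‖y - x‖ < r := by simpa [dist_eq_norm] using hy
    have h3 := abs_sub_abs_le_abs_sub (y γ) (x γ)
    simp only [ZeroAtInftyContinuousMap.sub_apply] at h1
    linarith
  rw [Set.Finite.mem_toFinset] at hi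
  rcases i with γ | ⟨⟨⟨γ, δ⟩, hγδ⟩, s⟩
  · have hγ : |x γ| ≤ r := by simpa [hS] using hi
    rw [abs_spikeFunctional_inl hθ, inv_mul_le_iff₀ (by linarith [hθ γ])]
    simp only [spikeMargin]
    nlinarith [hyx γ, hθ γ, hθ0 γ]
  · refine (abs_spikeFunctional_inr_le θ _ s y).trans ?_
    have hγδ' : r < |x γ| → |x δ| ≤ r := by simpa [hS] using hi
    have hm1 : min (θ γ) (θ δ) ≤ θ γ := min_le_left _ _
    have hm2 : min (θ γ) (θ δ) ≤ θ δ := min_le_right _ _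
    have := hyx γ
    have := hyx δ
    have := hθ γ
    simp only [spikeMargin]
    -- If `|x γ|` is large then `|x δ| ≤ r`, and `|x γ| ≤ 2 - θ γ` bounds the pair by `1 - θ γ / 2 +
    -- 3 * r / 2`, within the margin as `r < θ γ / 8`. If both are small, the pair stays below `1 /
    -- 2`.
    by_cases h1 : 1 / 4 < |x γ|
    · linarith [hγδ' (by linarith), hr γ h1, hxθ γ]
    · by_cases h2 : 1 / 4 < |x δ|
      · have h3 : |x γ| ≤ r := by
          by_contra! h
          linarith [hγδ' h]
        linarith [hr δ h2, hxθ δ]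
      · linarith

/-- `c₀(Γ)` has a smooth LFC norm which dominates `(|x γ| + |x δ|) / 2` for `γ ≠ δ` and whose unit
ball contains a multiple of each `single γ` that is almost `2` when `θ γ` is small. -/
theorem exists_spike_norm {θ : Γ → ℝ} (hθ0 : ∀ γ, 0 < θ γ) (hθ : ∀ γ, θ γ ≤ 1) :
    ∃ p : Seminorm ℝ C₀(Γ, ℝ), IsEquivNorm p ∧ IsSmoothNorm p ∧ IsLFCNorm p ∧
      (∀ x γ δ, γ ≠ δ → |x γ| + |x δ| ≤ 2 * p x) ∧
      ∀ γ, p ((2 - 2 * θ γ) • single γ) ≤ 1 := by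
  have hm0 : ∀ i, 0 < spikeMargin θ i := by
    rintro (γ | ⟨q, s⟩)
    · exact div_pos (hθ0 γ) four_pos
    · exact div_pos (lt_min (hθ0 _) (hθ0 _)) four_pos
  have hm : ∀ i, spikeMargin θ i ≤ 1 / 2 := by
    rintro (γ | ⟨q, s⟩)
    · simp only [spikeMargin]; linarith [hθ γ]
    · simp only [spikeMargin]; linarith [hθ q.1.1, min_le_left (θ q.1.1) (θ q.1.2)]
  have hle : ∀ i x, |spikeFunctional θ i x| ≤ ‖x‖ := by
    rintro (γ | ⟨q, s⟩) x
    · rw [abs_spikeFunctional_inl hθ, inv_mul_le_iff₀ (by linarith [hθ γ])]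
      nlinarith [hθ γ, norm_nonneg x, abs_apply_le_norm x γ]
    · linarith [abs_spikeFunctional_inr_le θ q s x, abs_apply_le_norm x q.1.1,
        abs_apply_le_norm x q.1.2]
  have hlow : ∀ x, (∀ i, |spikeFunctional θ i x| ≤ 1) → ‖x‖ ≤ 2 := by
    intro x hx
    refine norm_le_of_forall_abs_apply_le zero_le_two fun γ => ?_
    have := hx (.inl γ)
    rw [abs_spikeFunctional_inl hθ, inv_mul_le_iff₀ (by linarith [hθ γ])] at this
    linarith [hθ0 γ]
  obtain ⟨p, h1, h2, h3, h4, h5⟩ := exists_smooth_lfc_norm (spikeFunctional θ) (spikeMargin θ)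
    hm0 hm hle two_pos hlow (exists_finset_spikeFunctional_le hθ0 hθ)
  refine ⟨p, h1, h2, h3, fun x γ δ h =>
    abs_add_abs_le_of_spikeFunctional_le (fun i => h4 i x) h, fun γ => h5 _ ?_⟩
  have hθγ := hθ γ
  have hθγ0 := hθ0 γ
  have hself : |((2 - 2 * θ γ) • single γ : C₀(Γ, ℝ)) γ| = 2 - 2 * θ γ := by
    simp [abs_of_nonneg (by linarith : (0 : ℝ) ≤ 2 - 2 * θ γ)]
  have hne : ∀ {δ}, δ ≠ γ → |((2 - 2 * θ γ) • single γ : C₀(Γ, ℝ)) δ| = 0 := fun h => by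
    simp [single_of_ne h]
  rintro (δ | ⟨⟨⟨δ, δ'⟩, hδ⟩, s⟩)
  · rw [abs_spikeFunctional_inl hθ, inv_mul_le_iff₀ (by linarith [hθ δ])]
    simp only [spikeMargin]
    by_cases h : δ = γ
    · subst h
      rw [hself]
      nlinarith
    · rw [hne h]
      nlinarith [hθ δ]
  · refine (abs_spikeFunctional_inr_le θ _ s _).trans ?_
    have hm1 : min (θ δ) (θ δ') ≤ θ δ := min_le_left _ _
    have hm2 : min (θ δ) (θ δ') ≤ θ δ' := min_le_right _ _
    simp only [spikeMargin]
    have := hθ δ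
    by_cases h : δ = γ
    · subst h
      rw [hself, hne hδ.symm]
      linarith
    · rw [hne h]
      by_cases h' : δ' = γ
      · subst h'
        rw [hself]
        linarith
      · rw [hne h']
        linarith

/-- Take `1 / (n + 1)` along an embedded copy of `ℕ` and `1` elsewhere. Infinitely many small
weights are needed so that a spike can avoid the finitely many coordinates where a given direction
`h` is large. -/
theorem exists_pos_le_one_infinite_lt (Γ : Type*) [Infinite Γ] :
    ∃ θ : Γ → ℝ, (∀ γ, 0 < θ γ) ∧ (∀ γ, θ γ ≤ 1) ∧ ∀ ε > 0, {γ | θ γ < ε}.Infinite := by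
  set e := Infinite.natEmbedding Γ
  have he : ∀ n, Function.extend e (fun n : ℕ => 1 / ((n : ℝ) + 1)) 1 (e n) = 1 / ((n : ℝ) + 1) :=
    fun n => e.injective.extend_apply _ _ n
  have hcases : ∀ γ, (∃ n, e n = γ) ∨
      Function.extend e (fun n : ℕ => 1 / ((n : ℝ) + 1)) 1 γ = 1 := fun γ => by
    by_cases h : ∃ n, e n = γ
    · exact .inl h
    · exact .inr (Function.extend_apply' _ _ _ h)
  refine ⟨Function.extend e (fun n : ℕ => 1 / ((n : ℝ) + 1)) 1, fun γ => ?_, fun γ => ?_,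
    fun ε hε => ?_⟩
  · rcases hcases γ with ⟨n, rfl⟩ | h
    · rw [he]; positivity
    · rw [h]; exact one_pos
  · rcases hcases γ with ⟨n, rfl⟩ | h
    · rw [he, div_le_one (by positivity)]
      linarith [n.cast_nonneg (α := ℝ)]
    · exact h.le
  · obtain ⟨N, hN⟩ := exists_nat_one_div_lt hε
    refine ((Set.Ici_infinite N).image e.injective.injOn).mono ?_
    rintro _ ⟨n, hn, rfl⟩
    rw [Set.mem_ofPred_eq, he]
    exact (Nat.one_div_le_one_div hn).trans_lt hN

/-! ### Geometric consequences of the spikes. -/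

theorem isDentable_closedBall_of_spikes {p : Seminorm ℝ C₀(Γ, ℝ)}
    {θ : Γ → ℝ} (hθ0 : ∀ γ, 0 < θ γ) (hθ : ∀ ε > 0, {γ | θ γ < ε}.Infinite)
    (h1 : ∀ x γ δ, γ ≠ δ → |x γ| + |x δ| ≤ 2 * p x)
    (h2 : ∀ γ, p ((2 - 2 * θ γ) • single γ) ≤ 1) : IsDentable (p.closedBall 0 1) := by
  intro ε hε
  obtain ⟨γ, hγ⟩ := (hθ (min (1 / 2) (ε / 7)) (lt_min (by norm_num) (by linarith))).nonempty
  -- Any second index serves: the pair constraint with it yields `|x γ| ≤ 2` on the ball.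
  obtain ⟨δ, hδ⟩ := ((hθ 1 one_pos).sdiff (Set.finite_singleton γ)).nonempty
  have hγ1 : θ γ < 1 / 2 := hγ.trans_le (min_le_left _ _)
  have hγ2 : θ γ < ε / 7 := hγ.trans_le (min_le_right _ _)
  have hpos := hθ0 γ
  -- On this slice `x γ` lies in `(2 - 3 * θ γ, 2]` and every other coordinate is below `3 * θ γ` in
  -- absolute value, so distances are at most `6 * θ γ < ε`.
  refine ⟨evalCLM γ, 2 - 3 * θ γ, by linarith, ⟨(2 - 2 * θ γ) • single γ, ?_, ?_⟩, ?_⟩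
  · simpa [Seminorm.mem_closedBall] using h2 γ
  · simp only [evalCLM_apply, ZeroAtInftyContinuousMap.smul_apply, single_self, smul_eq_mul]
    linarith
  · refine lt_of_le_of_lt (Metric.ediam_le (d := ENNReal.ofReal (6 * θ γ)) ?_)
      ((ENNReal.ofReal_lt_ofReal_iff hε).2 (by linarith))
    rintro x ⟨hx, hxa⟩ y ⟨hy, hya⟩
    rw [Seminorm.mem_closedBall, sub_zero] at hx hy
    simp only [evalCLM_apply] at hxa hya
    rw [edist_dist, dist_eq_norm]
    refine ENNReal.ofReal_le_ofReal
      (norm_le_of_forall_abs_apply_le (by linarith) fun β => ?_)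
    rw [ZeroAtInftyContinuousMap.sub_apply]
    by_cases hβ : β = γ
    · subst hβ
      have := h1 x β δ (Ne.symm hδ.2)
      have := h1 y β δ (Ne.symm hδ.2)
      rw [abs_le]
      constructor <;> linarith [le_abs_self (x β), le_abs_self (y β), abs_nonneg (x δ),
        abs_nonneg (y δ)]
    · have := h1 x γ β (Ne.symm hβ)
      have := h1 y γ β (Ne.symm hβ)
      linarith [abs_sub (x β) (y β), le_abs_self (x γ), le_abs_self (y γ)]

end

theorem symmQuotient_smul {E : Type*} [NormedAddCommGroup E] [NormedSpace ℝ E]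
    (p : Seminorm ℝ E) (x h : E) (t : ℝ) {a : ℝ} (ha : 0 < a) :
    symmQuotient p (a • x) h (a * t) = symmQuotient p x h t := by
  unfold symmQuotient
  rw [mul_smul, ← smul_add, ← smul_sub, map_smul_eq_mul, map_smul_eq_mul, map_smul_eq_mul,
    Real.norm_of_nonneg ha.le, ← mul_div_mul_left _ t ha.ne']
  congr 1
  ring

theorem not_isUniformlyGateaux_of_spikes {Γ : Type*} [TopologicalSpace Γ] [DiscreteTopology Γ]
    {p : Seminorm ℝ C₀(Γ, ℝ)}
    {θ : Γ → ℝ} (hθ0 : ∀ γ, 0 < θ γ) (hθ : ∀ ε > 0, {γ | θ γ < ε}.Infinite)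
    (h1 : ∀ x γ δ, γ ≠ δ → |x γ| + |x δ| ≤ 2 * p x)
    (h2 : ∀ γ, p ((2 - 2 * θ γ) • single γ) ≤ 1) {h : C₀(Γ, ℝ)} (hh : h ≠ 0) :
    ¬ IsUniformlyGateaux p h := by
  rintro ⟨q, ⟨c, C, hc, hC, hcC⟩, hq⟩
  obtain ⟨γ, hγ⟩ : ∃ γ, h γ ≠ 0 := by
    by_contra! hcon
    exact hh (ZeroAtInftyContinuousMap.ext hcon)
  set d := |h γ|
  have hd : 0 < d := abs_pos.2 hγ
  have hq' := Metric.tendstoUniformlyOn_iff.1 hq (d / 4) (by positivity)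
  obtain ⟨ρ, hρ, hball⟩ := Metric.eventually_nhds_iff.1 (eventually_nhdsWithin_iff.1 hq')
  -- `|h δ| ≤ d / 2` makes the loss at `δ` at most half the gain at `γ`. The bound `ρ * d * c / 8`
  -- brings the step below `ρ` after normalising by `q x ≥ c`.
  obtain ⟨δ, ⟨hδ, hδγ⟩, hδh⟩ := (((hθ (min (1 / 2) (ρ * d * c / 8)) (by positivity)).sdiff
    (Set.finite_singleton γ)).sdiff (finite_setOf_lt_abs h (half_pos hd))).nonempty
  have hδγ : γ ≠ δ := Ne.symm hδγ
  have hδh : |h δ| ≤ d / 2 := not_lt.1 hδh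
  have hθ1 : θ δ < 1 / 2 := hδ.trans_le (min_le_left _ _)
  have hθ2 : θ δ < ρ * d * c / 8 := hδ.trans_le (min_le_right _ _)
  have hpos := hθ0 δ
  set x : C₀(Γ, ℝ) := (2 - 2 * θ δ) • single δ with hx
  have hxδ : x δ = 2 - 2 * θ δ := by simp [hx]
  have hxγ : x γ = 0 := by simp [hx, single_of_ne hδγ]
  -- This step gains `8 * θ δ` at `γ` and loses at most `4 * θ δ` at `δ`, beating the spike's
  -- deficit `2 * θ δ`. Thus `p (x ± τ • h) ≥ 1 + θ δ` while `p x ≤ 1`, and the quotient is at least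
  -- `2 * θ δ / τ = d / 4`.
  set τ := 8 * θ δ / d with hτ
  have hτ0 : 0 < τ := by positivity
  have hτd : τ * d = 8 * θ δ := div_mul_cancel₀ _ hd.ne'
  have hτδ : |τ * h δ| ≤ 4 * θ δ := by
    rw [abs_mul, abs_of_pos hτ0]
    nlinarith
  have hτγ : |τ * h γ| = 8 * θ δ := by rw [abs_mul, abs_of_pos hτ0, hτd]
  have hplus : 2 + 2 * θ δ ≤ 2 * p (x + τ • h) := by
    refine le_trans ?_ (h1 _ γ δ hδγ)
    simp only [ZeroAtInftyContinuousMap.add_apply, ZeroAtInftyContinuousMap.smul_apply,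
      smul_eq_mul, hxγ, hxδ, zero_add, hτγ]
    linarith [le_abs_self (2 - 2 * θ δ + τ * h δ), neg_abs_le (τ * h δ)]
  have hminus : 2 + 2 * θ δ ≤ 2 * p (x - τ • h) := by
    refine le_trans ?_ (h1 _ γ δ hδγ)
    simp only [ZeroAtInftyContinuousMap.sub_apply, ZeroAtInftyContinuousMap.smul_apply,
      smul_eq_mul, hxγ, hxδ, zero_sub, abs_neg, hτγ]
    linarith [le_abs_self (2 - 2 * θ δ - τ * h δ), le_abs_self (τ * h δ)]
  have hquot : d / 4 ≤ symmQuotient p x h τ := by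
    unfold symmQuotient
    rw [le_div_iff₀ hτ0]
    linarith [h2 δ]
  have hqx : c ≤ q x := by
    refine le_trans ?_ (hcC x).1
    have := (le_abs_self _).trans (abs_apply_le_norm x δ)
    nlinarith
  have hqx0 : 0 < q x := hc.trans_le hqx
  have ht0 : 0 < (q x)⁻¹ * τ := mul_pos (inv_pos.2 hqx0) hτ0
  have htρ : (q x)⁻¹ * τ < ρ := by
    rw [inv_mul_lt_iff₀ hqx0, hτ, div_lt_iff₀ hd]
    nlinarith [mul_le_mul_of_nonneg_right hqx (mul_pos hρ hd).le]
  have := hball (y := (q x)⁻¹ * τ) (by rwa [Real.dist_0_eq_abs, abs_of_pos ht0])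
    (Set.mem_compl_singleton_iff.2 ht0.ne') ((q x)⁻¹ • x) (by
      rw [Set.mem_ofPred_eq, map_smul_eq_mul, Real.norm_of_nonneg (inv_nonneg.2 hqx0.le),
        inv_mul_cancel₀ hqx0.ne'])
  rw [symmQuotient_smul _ _ _ _ (inv_pos.2 hqx0), dist_comm, Real.dist_0_eq_abs] at this
  linarith [le_abs_self (symmQuotient p x h τ)]

theorem theoremB (Γ : Type*) [TopologicalSpace Γ] [DiscreteTopology Γ] [Infinite Γ] :
    ∃ p : Seminorm ℝ C₀(Γ, ℝ),
      IsEquivNorm p ∧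
      IsSmoothNorm p ∧
      IsLFCNorm p ∧
      IsDentable (p.closedBall 0 1) ∧
      (∀ h : C₀(Γ, ℝ), h ≠ 0 → ¬ IsUniformlyGateaux p h) ∧
      Set.extremePoints ℝ (p.closedBall 0 1) = ∅ := by
  obtain ⟨θ, hθ0, hθ1, hθ⟩ := exists_pos_le_one_infinite_lt Γ
  obtain ⟨p, hp, hs, hlfc, h1, h2⟩ := exists_spike_norm hθ0 hθ1
  exact ⟨p, hp, hs, hlfc, isDentable_closedBall_of_spikes hθ0 hθ h1 h2,
    fun _ hh => not_isUniformlyGateaux_of_spikes hθ0 hθ h1 h2 hh,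
    hlfc.extremePoints_closedBall_eq_empty not_finiteDimensional⟩
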